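/- Let $K$ be a finite simplicial complex, $\mathbb F$ a field, and let homology have coefficients in $\mathbb F$. A filtration function on $K$ is a function $f\colon K\to\mathbb R$ with $f(\sigma)\le f(\tau)$ whenever $\sigma$ is a face of $\tau$; all filtration functions below are injective. Put $K^f_r=f^{-1}((-\infty,r])$ and $\|f-g\|_\infty=\max_{\sigma\in K}|f(\sigma)-g(\sigma)|$. A non-trivial class $x\in H_n(K^f_r)$ is born at the infimum of the levels $q\le r$ for which $x$ lies in the image of $H_n(K^f_q)$, and terminates at the infimum of the levels $q\ge r$ at which its image in $H_n(K^f_q)$ is zero ($\infty$ if there is no such level). An $m$-simplex $\tau$ is a birth simplex of $f$ if some non-trivial class of $H_m(K^f_{f(\tau)})$ is born at $f(\tau)$, and a terminal simplex of $f$ if $m\geq 1$ and some non-trivial class of some $H_{m-1}(K^f_r)$ terminates at $f(\tau)$. A decomposition of the persistence module $\{H_n(K^f_r)\}_{r\in\mathbb R}$ into a finite direct sum of interval modules $\mathbb F_{[a_i,b_i)}$, $a_i\in\mathbb R$, $a_i<b_i\le\infty$, gives its bars $[a_i,b_i)$, $i\in I$. If $b_i<\infty$, the simplex terminating the bar $[a_i,b_i)$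 is the terminal $(n+1)$-simplex of $f$ with value $b_i$. Let $f$ be an injective filtration function on $K$, let $n\ge 0$, and let $[a,b)=[a_{i_0},b_{i_0})$ be a bar of $\{H_n(K^f_r)\}_{r}$ represented by $[\alpha]\in H_n(K^f_a)$, a homology class born at $a$ and terminating at $b$. Let $\varepsilon<(b-a)/4$ and assume that every other bar $[a_i,b_i)$, $i\neq i_0$, satisfies $a_i>a+2\varepsilon$ or $b_i<b-2\varepsilon$. Let $g$ be an injective filtration function with $\|f-g\|_\infty\le\varepsilon$, and let $[a'_j,b'_j)$, $j\in J$, be the bars of $\{H_n(K^g_r)\}_{r}$. Let $\varphi\colon I'\to J'$ be any bijection between subsets $I'\subseteq I$, $J'\subseteq J$ such that $|a_i-a'_{\varphi(i)}|\le\varepsilon$ and $|b_i-b'_{\varphi(i)}|\le\varepsilon$ for $i\in I'$ (where $|\infty-\infty|=0$), and all bars indexed by $I\setminus I'$ and $J\setminus J'$ have length at most $2\varepsilon$; assume that $\varphi$ matches $[a,b)$ to the bar $[a',b')$ of $g$. Then: (1) the image of $[\alpha]$ in $H_n(K^g_{a+\varepsilon})$, under the map induced by $K^f_a\subseteq K^g_{a+\varepsilon}$,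 is non-trivial and terminates at $b'$ in the filtration of $g$; (2) if $b<\infty$ and $\varepsilon\le\frac12\min\{R_u,R_l\}$, where $R_u=\min\{|f(\tau)-b| : \tau$ a birth $(n+1)$-simplex of $f$ with $f(\tau)>b\}$ and $R_l=\min\{|f(\tau)-b| : \tau$ a terminal $(n+1)$-simplex of $f$ with $f(\tau)<b\}$ (each $\infty$ if the set is empty), then the unique simplex terminating $[a,b)$ in $K^f$ exists and is the same as the unique simplex terminating $[a',b')$ in $K^g$. -/

import Mathlib

set_option maxSynthPendingDepth 3
set_option linter.unusedSectionVars false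

noncomputable section

namespace PersistentRigidity

universe u v w w'

/-! ## Simplicial homology with field coefficients

Vertices carry a linear order, which orients every simplex. A chain is a finitely supported
function on finite vertex sets; an `n`-simplex is a face with `n + 1` vertices. -/

section Homology

variable {V : Type u} [LinearOrder V] (F : Type v) [Field F]

/-- The oriented boundary of a simplex: the alternating sum of its facets, where the sign of the
facet opposite to `x` is given by the position of `x` in `s`. Vertices have boundary zero
(unreduced homology). -/
def simplexBoundary (s : Finset V) : Finset V →₀ F :=
  if s.card ≤ 1 then 0
  else ∑ x ∈ s, Finsupp.single (s.erase x) ((-1 : F) ^ (s.filter (fun y => y < x)).card)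

/-- The boundary operator on chains. -/
def boundary : (Finset V →₀ F) →ₗ[F] (Finset V →₀ F) :=
  Finsupp.linearCombination F (simplexBoundary F)

/-- `C_n(L)`: chains supported on the `n`-simplices of `L`. -/
def chains (L : PreAbstractSimplicialComplex V) (n : ℕ) : Submodule F (Finset V →₀ F) :=
  Finsupp.supported F F {s : Finset V | s ∈ L ∧ s.card = n + 1}

/-- `Z_n(L)`: the `n`-cycles of `L`. -/
def cycles (L : PreAbstractSimplicialComplex V) (n : ℕ) : Submodule F (Finset V →₀ F) :=
  chains F L n ⊓ LinearMap.ker (boundary F)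

/-- `B_n(L)`: the boundaries of `(n+1)`-chains of `L`. -/
def boundaries (L : PreAbstractSimplicialComplex V) (n : ℕ) : Submodule F (Finset V →₀ F) :=
  (chains F L (n + 1)).map (boundary F)

theorem chains_mono {L L' : PreAbstractSimplicialComplex V} (h : L ≤ L') (n : ℕ) :
    chains F L n ≤ chains F L' n :=
  Finsupp.supported_mono (fun _ hs => ⟨h hs.1, hs.2⟩)

theorem cycles_mono {L L' : PreAbstractSimplicialComplex V} (h : L ≤ L') (n : ℕ) :
    cycles F L n ≤ cycles F L' n :=
  inf_le_inf_right _ (chains_mono F h n)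

theorem boundaries_mono {L L' : PreAbstractSimplicialComplex V} (h : L ≤ L') (n : ℕ) :
    boundaries F L n ≤ boundaries F L' n :=
  Submodule.map_mono (chains_mono F h (n + 1))

/-- `H_n(L) = Z_n(L) / B_n(L)` with coefficients in `F`. -/
abbrev homology (L : PreAbstractSimplicialComplex V) (n : ℕ) : Type (max u v) :=
  cycles F L n ⧸ (boundaries F L n).submoduleOf (cycles F L n)

/-- The map on homology induced by the inclusion of a subcomplex. -/
def homologyMap {L L' : PreAbstractSimplicialComplex V} (h : L ≤ L') (n : ℕ) :
    homology F L n →ₗ[F] homology F L' n :=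
  Submodule.mapQ _ _ (Submodule.inclusion (cycles_mono F h n))
    (fun _ hx => boundaries_mono F h n hx)

theorem homologyMap_id (L : PreAbstractSimplicialComplex V) (n : ℕ) (x : homology F L n) :
    homologyMap F (le_refl L) n x = x := by
  induction x using Submodule.Quotient.induction_on with
  | _ z => rfl

theorem homologyMap_comp {L₁ L₂ L₃ : PreAbstractSimplicialComplex V} (h₁ : L₁ ≤ L₂)
    (h₂ : L₂ ≤ L₃) (n : ℕ) (x : homology F L₁ n) :
    homologyMap F h₂ n (homologyMap F h₁ n x) = homologyMap F (h₁.trans h₂) n x := by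
  induction x using Submodule.Quotient.induction_on with
  | _ z => rfl

end Homology

/-! ## Persistence modules, births, terminations and interval decompositions -/

/-- A persistence module over `F` indexed by `ℝ`. -/
structure PersistenceModule (F : Type v) [Field F] where
  obj : ℝ → Type w
  [addCommGroup : ∀ r, AddCommGroup (obj r)]
  [module : ∀ r, Module F (obj r)]
  map : ∀ {q r : ℝ}, q ≤ r → (obj q →ₗ[F] obj r)
  map_id : ∀ (r : ℝ) (x : obj r), map (le_refl r) x = x
  map_comp : ∀ {q r s : ℝ} (h₁ : q ≤ r) (h₂ : r ≤ s) (x : obj q),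
    map h₂ (map h₁ x) = map (h₁.trans h₂) x

attribute [instance] PersistenceModule.addCommGroup PersistenceModule.module

namespace PersistenceModule

variable {F : Type v} [Field F]

/-- The birth of `x`: the infimum of the levels `q ≤ r` from which `x` comes. -/
def birth (M : PersistenceModule.{v, w} F) {r : ℝ} (x : M.obj r) : EReal :=
  sInf {s : EReal | ∃ (q : ℝ) (h : q ≤ r), s = (q : EReal) ∧ ∃ y : M.obj q, M.map h y = x}

/-- The termination scale of `x`: the infimum of the levels `q ≥ r` at which `x` becomes zero,
and `∞` if there is no such level. -/
def terminationScale (M : PersistenceModule.{v, w} F) {r : ℝ} (x : M.obj r) : EReal :=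
  sInf {s : EReal | ∃ (q : ℝ) (h : r ≤ q), s = (q : EReal) ∧ M.map h x = 0}

/-- The non-trivial element `x` is born at `a`. -/
def IsBornAt (M : PersistenceModule.{v, w} F) {r : ℝ} (x : M.obj r) (a : EReal) : Prop :=
  x ≠ 0 ∧ M.birth x = a

/-- The non-trivial element `x` is terminated at `b`. -/
def IsTerminatedAt (M : PersistenceModule.{v, w} F) {r : ℝ} (x : M.obj r) (b : EReal) : Prop :=
  x ≠ 0 ∧ M.terminationScale x = b

/-- An isomorphism of persistence modules. -/
structure Iso (M : PersistenceModule.{v, w} F) (N : PersistenceModule.{v, w'} F) where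
  equiv : ∀ r : ℝ, M.obj r ≃ₗ[F] N.obj r
  comm : ∀ {q r : ℝ} (h : q ≤ r) (x : M.obj q), equiv r (M.map h x) = N.map h (equiv q x)

variable (F) in
/-- The space of the interval module of `[a, b)` at level `r`: it is `F` if `r ∈ [a, b)` and zero
otherwise. -/
def intervalSpace (a : ℝ) (b : EReal) (r : ℝ) : Submodule F F where
  carrier := {x : F | ¬ (a ≤ r ∧ (r : EReal) < b) → x = 0}
  add_mem' hx hy := fun h => by rw [hx h, hy h, add_zero]
  zero_mem' := fun _ => rfl
  smul_mem' c x hx := fun h => by rw [hx h, smul_zero]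

open scoped Classical in
variable (F) in
/-- The interval module of `[a, b)`; its maps are identities inside `[a, b)` and zero otherwise. -/
def intervalModule (a : ℝ) (b : EReal) : PersistenceModule.{v, v} F where
  obj r := intervalSpace F a b r
  map {q r} _ :=
    { toFun := fun x => ⟨if a ≤ r ∧ (r : EReal) < b then (x : F) else 0, fun h => if_neg h⟩
      map_add' := fun x y => by
        apply Subtype.ext
        by_cases h : a ≤ r ∧ (r : EReal) < b <;> simp [h]
      map_smul' := fun c x => by
        apply Subtype.ext
        by_cases h : a ≤ r ∧ (r : EReal) < b <;> simp [h] }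
  map_id r x := by
    apply Subtype.ext
    by_cases h : a ≤ r ∧ (r : EReal) < b
    · simp [h]
    · have := x.2 h
      simp [this]
  map_comp {q r s} h₁ h₂ x := by
    apply Subtype.ext
    by_cases hs : a ≤ s ∧ (s : EReal) < b
    · by_cases hr : a ≤ r ∧ (r : EReal) < b
      · simp [hs, hr]
      · have hq : ¬ (a ≤ q ∧ (q : EReal) < b) := fun hq =>
          hr ⟨hq.1.trans h₁, lt_of_le_of_lt (EReal.coe_le_coe_iff.mpr h₂) hs.2⟩
        have := x.2 hq
        simp [this]
    · simp [hs]

/-- The direct sum of a finite family of persistence modules. -/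
def finiteSum {I : Type w'} [Finite I] (M : I → PersistenceModule.{v, w} F) :
    PersistenceModule.{v, max w w'} F where
  obj r := ∀ i, (M i).obj r
  map h := LinearMap.pi (fun i => ((M i).map h).comp (LinearMap.proj i))
  map_id r x := funext fun i => (M i).map_id r (x i)
  map_comp h₁ h₂ x := funext fun i => (M i).map_comp h₁ h₂ (x i)

/-- A decomposition of `M` into a finite direct sum of interval modules; the family of intervals
`[lo i, hi i)` is the barcode of `M` (with multiplicities). -/
structure IntervalDecomposition (M : PersistenceModule.{v, w} F) (I : Type w') [Finite I] where
  lo : I → ℝ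
  hi : I → EReal
  lo_lt_hi : ∀ i, (lo i : EReal) < hi i
  iso : Iso M (finiteSum (fun i => intervalModule F (lo i) (hi i)))

/-- A partial matching of two barcodes of bottleneck cost at most `ε`: a bijection between subsets
of the two families of bars that moves endpoints by at most `ε` (an infinite endpoint is within
`ε` of an infinite endpoint only), while unmatched bars have length at most `2ε`. -/
structure Matching {M : PersistenceModule.{v, w} F} {N : PersistenceModule.{v, w'} F}
    {I J : Type*} [Finite I] [Finite J] (ε : ℝ)
    (D : IntervalDecomposition M I) (E : IntervalDecomposition N J) where
  I' : Set I
  J' : Set J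
  φ : I' ≃ J'
  lo_close : ∀ i : I', |D.lo i - E.lo (φ i)| ≤ ε
  hi_close : ∀ i : I', D.hi i ≤ E.hi (φ i) + (ε : EReal) ∧ E.hi (φ i) ≤ D.hi i + (ε : EReal)
  short_left : ∀ i : I, i ∉ I' → D.hi i ≤ ((D.lo i + 2 * ε : ℝ) : EReal)
  short_right : ∀ j : J, j ∉ J' → E.hi j ≤ ((E.lo j + 2 * ε : ℝ) : EReal)

/-- The matching matches bar `i` to bar `j`. -/
def Matching.Matches {M : PersistenceModule.{v, w} F} {N : PersistenceModule.{v, w'} F}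
    {I J : Type*} [Finite I] [Finite J] {ε : ℝ}
    {D : IntervalDecomposition M I} {E : IntervalDecomposition N J}
    (m : Matching ε D E) (i : I) (j : J) : Prop :=
  ∃ h : i ∈ m.I', (m.φ ⟨i, h⟩ : J) = j

end PersistenceModule

/-! ## Sublevel filtrations of a simplicial complex -/

section Filtrations

variable {V : Type u} [LinearOrder V]

/-- An injective filtration function on the simplices of `K`. -/
structure FiltrationFunction (K : PreAbstractSimplicialComplex V) where
  toFun : K → ℝ
  mono : ∀ σ τ : K, (σ : Finset V) ⊆ (τ : Finset V) → toFun σ ≤ toFun τ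
  injective : Function.Injective toFun

instance (K : PreAbstractSimplicialComplex V) : CoeFun (FiltrationFunction K) (fun _ => K → ℝ) :=
  ⟨FiltrationFunction.toFun⟩

variable {K : PreAbstractSimplicialComplex V}

/-- The sublevel complex `K^f_r = f⁻¹((-∞, r])`. -/
def sublevel (f : FiltrationFunction K) (r : ℝ) : PreAbstractSimplicialComplex V where
  faces := {s : Finset V | ∃ h : s ∈ K, f ⟨s, h⟩ ≤ r}
  isRelLowerSet_faces := by
    rintro s ⟨hs, hr⟩
    refine ⟨(K.isRelLowerSet_faces hs).1, fun t hts ht => ?_⟩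
    have htK : t ∈ K := (K.isRelLowerSet_faces hs).2 hts ht
    exact ⟨htK, (f.mono ⟨t, htK⟩ ⟨s, hs⟩ hts).trans hr⟩

theorem sublevel_mono (f : FiltrationFunction K) {q r : ℝ} (h : q ≤ r) :
    sublevel f q ≤ sublevel f r :=
  fun _ hs => ⟨hs.1, hs.2.trans h⟩

theorem sublevel_le_of_norm_le [Fintype K] (f g : FiltrationFunction K) {ε : ℝ}
    (h : ‖f.toFun - g.toFun‖ ≤ ε) (r : ℝ) : sublevel f r ≤ sublevel g (r + ε) := by
  rintro s ⟨hs, hr⟩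
  refine ⟨hs, ?_⟩
  have h1 := (norm_le_pi_norm (f.toFun - g.toFun) ⟨s, hs⟩).trans h
  rw [Pi.sub_apply, Real.norm_eq_abs, abs_le] at h1
  linarith [h1.1]

variable (F : Type v) [Field F]

/-- The persistence module `{H_n(K^f_r)}_r`. -/
def persistentHomology (f : FiltrationFunction K) (n : ℕ) :
    PersistenceModule.{v, max u v} F where
  obj r := homology F (sublevel f r) n
  map h := homologyMap F (sublevel_mono f h) n
  map_id r x := homologyMap_id F (sublevel f r) n x
  map_comp h₁ h₂ x := homologyMap_comp F (sublevel_mono f h₁) (sublevel_mono f h₂) n x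

/-- If `‖f - g‖_∞ ≤ ε`, then `K^f_r ⊆ K^g_{r+ε}`, and so a class in `H_n(K^f_r)` is a class in
`H_n(K^g_{r+ε})`. -/
def perturbationMap [Fintype K] (f g : FiltrationFunction K) {ε : ℝ}
    (h : ‖f.toFun - g.toFun‖ ≤ ε) (n : ℕ) (r : ℝ) :
    (persistentHomology F f n).obj r →ₗ[F] (persistentHomology F g n).obj (r + ε) :=
  homologyMap F (sublevel_le_of_norm_le f g h r) n

/-- `τ` is a birth `m`-simplex of the filtration `K^f`: an `m`-simplex whose arrival gives birth
to a non-trivial class of `H_m`. -/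
def IsBirthSimplex (f : FiltrationFunction K) (m : ℕ) (τ : K) : Prop :=
  (τ : Finset V).card = m + 1 ∧
    ∃ x : (persistentHomology F f m).obj (f τ), (persistentHomology F f m).IsBornAt x (f τ)

/-- `τ` is a terminal `(n+1)`-simplex of the filtration `K^f`: an `(n+1)`-simplex whose arrival
terminates a non-trivial class of `H_n`. -/
def IsTerminalSimplex (f : FiltrationFunction K) (n : ℕ) (τ : K) : Prop :=
  (τ : Finset V).card = n + 2 ∧
    ∃ (r : ℝ) (x : (persistentHomology F f n).obj r),
      (persistentHomology F f n).IsTerminatedAt x (f τ)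

/-- `τ` terminates a bar of `{H_n(K^f_r)}_r` with right endpoint `b`: it is the terminal
`(n+1)`-simplex that arrives at level `b`. -/
def TerminatesBar (f : FiltrationFunction K) (n : ℕ) (b : EReal) (τ : K) : Prop :=
  IsTerminalSimplex F f n τ ∧ (f τ : EReal) = b

/-- `R_u`: the distance from `b` to the next birth `(n+1)`-simplex above `b`, or `∞`. -/
def upperGap (f : FiltrationFunction K) (n : ℕ) (b : ℝ) : EReal :=
  sInf {x : EReal | ∃ τ : K, IsBirthSimplex F f (n + 1) τ ∧ b < f τ ∧
    x = ((|f τ - b| : ℝ) : EReal)}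

/-- `R_l`: the distance from `b` to the previous terminal `(n+1)`-simplex below `b`, or `∞`. -/
def lowerGap (f : FiltrationFunction K) (n : ℕ) (b : ℝ) : EReal :=
  sInf {x : EReal | ∃ τ : K, IsTerminalSimplex F f n τ ∧ f τ < b ∧
    x = ((|f τ - b| : ℝ) : EReal)}

end Filtrations

end PersistentRigidity

end

namespace PersistentRigidity

open Filter Topology

universe u v w w'

/-! ## Chains and boundaries -/

section Chains

variable {V : Type u} [LinearOrder V] (F : Type v) [Field F]

/-! Write a, b for the endpoints of the bar `i₀`, b' for the right endpoint of `j₀`, and β for the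
image of α in the filtration of g. Part (1): β terminates at the right end of some bar j of g on
which it has a non-zero component. That bar starts at or before a + ε, since β lives there, and ends
at or after b - ε, since the sublevel complexes of f and g are interleaved. It is therefore longer
than 2ε, hence matched, and its partner starts by a + 2ε and ends no earlier than b - 2ε. Isolation
forces the partner to be `i₀`, so j is `j₀` (`isTerminatedAt_perturbationMap`). Part (2): one cycle
z represents α and β; it becomes a boundary at b for f and at b' for g. Every filling of z in the
sublevel complex of g at b' contains the simplex τ with g τ = b'. If f τ > b, comparison with a
filling for f gives an (n+1)-cycle, whose highest simplex is a birth simplex too close above b. If f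
τ < b, the gap below b lets ∂τ be filled early, without τ, so τ can be exchanged for older
simplices. Apart from the extreme case b' = b - ε, treated directly, both conclusions contradict the
minimality of b' (`exists_common_simplex_of_becomesBoundaryAt`). -/

theorem mem_chains_iff {L : PreAbstractSimplicialComplex V} {n : ℕ} {c : Finset V →₀ F} :
    c ∈ chains F L n ↔ ∀ s, c s ≠ 0 → s ∈ L ∧ s.card = n + 1 := by
  rw [chains, Finsupp.mem_supported]
  exact ⟨fun h s hs => h (Finsupp.mem_support_iff.2 hs),
    fun h s hs => h s (Finsupp.mem_support_iff.1 hs)⟩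

theorem boundary_single (s : Finset V) (a : F) :
    boundary F (Finsupp.single s a) = a • simplexBoundary F s := by
  simp [boundary]

theorem exists_eq_erase_of_simplexBoundary_ne_zero {s t : Finset V}
    (h : simplexBoundary F s t ≠ 0) : 1 < s.card ∧ ∃ x ∈ s, t = s.erase x := by
  unfold simplexBoundary at h
  split_ifs at h with hs
  · simp at h
  · refine ⟨not_le.1 hs, ?_⟩
    rw [Finsupp.finsetSum_apply] at h
    obtain ⟨x, hx, hne⟩ := Finset.exists_ne_zero_of_sum_ne_zero h
    refine ⟨x, hx, ?_⟩
    by_contra hc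
    exact hne (Finsupp.single_eq_of_ne hc)

/-- Interchanging the order in which two vertices are deleted changes the sign. -/
theorem erase_sign_add_swap {s : Finset V} {x y : V} (hx : x ∈ s) (hxy : x < y) :
    (-1 : F) ^ (s.filter (fun z => z < x)).card *
        (-1 : F) ^ ((s.erase x).filter (fun z => z < y)).card +
      (-1 : F) ^ (s.filter (fun z => z < y)).card *
        (-1 : F) ^ ((s.erase y).filter (fun z => z < x)).card = 0 := by
  -- Deleting the larger vertex keeps the position of the smaller one; deleting the smaller lowers
  -- that of the larger by one. This is the source of the sign change.
  have h1 : (s.erase y).filter (fun z => z < x) = s.filter (fun z => z < x) := by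
    ext z
    simp only [Finset.mem_filter, Finset.mem_erase]
    exact ⟨fun h => ⟨h.1.2, h.2⟩, fun h => ⟨⟨(h.2.trans hxy).ne, h.1⟩, h.2⟩⟩
  have h2 : (s.erase x).filter (fun z => z < y) = (s.filter (fun z => z < y)).erase x := by
    ext z
    simp only [Finset.mem_filter, Finset.mem_erase]
    tauto
  have hmem : x ∈ s.filter (fun z => z < y) := Finset.mem_filter.2 ⟨hx, hxy⟩
  rw [h1, h2, ← Finset.card_erase_add_one hmem, pow_succ]
  ring

theorem boundary_simplexBoundary (s : Finset V) : boundary F (simplexBoundary F s) = 0 := by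
  -- Edges are separate: their facets are vertices, whose boundary is zero by convention and not
  -- given by the alternating sum.
  by_cases hs : s.card ≤ 2
  · by_cases hs1 : s.card ≤ 1
    · simp [simplexBoundary, hs1]
    · rw [simplexBoundary, if_neg hs1, map_sum]
      refine Finset.sum_eq_zero fun x hx => ?_
      have : (s.erase x).card ≤ 1 := by
        rw [Finset.card_erase_of_mem hx]
        omega
      rw [boundary_single, simplexBoundary, if_pos this, smul_zero]
  · have key : boundary F (simplexBoundary F s) = ∑ p ∈ s.offDiag,
        Finsupp.single ((s.erase p.1).erase p.2)
          ((-1 : F) ^ (s.filter (fun z => z < p.1)).card *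
            (-1 : F) ^ ((s.erase p.1).filter (fun z => z < p.2)).card) := by
      rw [simplexBoundary, if_neg (by omega), map_sum]
      have hd : s.offDiag = (s.sigma (fun x => s.erase x)).map
          ⟨fun p => (p.1, p.2), fun p q h => by
            cases p; cases q; simp only [Prod.mk.injEq] at h; simp [h.1, h.2]⟩ := by
        ext ⟨x, y⟩
        simp only [Finset.mem_offDiag, Finset.mem_map, Finset.mem_sigma, Finset.mem_erase,
          Sigma.exists]
        constructor
        · rintro ⟨hx, hy, hne⟩
          exact ⟨x, y, ⟨hx, Ne.symm hne, hy⟩, rfl⟩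
        · rintro ⟨x', y', ⟨hx, hne, hy⟩, h⟩
          cases h
          exact ⟨hx, hy, Ne.symm hne⟩
      rw [hd, Finset.sum_map, Finset.sum_sigma]
      refine Finset.sum_congr rfl fun x hx => ?_
      have hcard : ¬ (s.erase x).card ≤ 1 := by
        rw [Finset.card_erase_of_mem hx]
        omega
      rw [boundary_single, simplexBoundary, if_neg hcard, Finset.smul_sum]
      exact Finset.sum_congr rfl fun y _ => by
        rw [Finsupp.smul_single, smul_eq_mul]; rfl
    rw [key]
    -- Each codimension-two face arises from two ordered pairs of deleted vertices, with opposite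
    -- signs.
    refine Finset.sum_involution (fun p _ => (p.2, p.1)) ?_ ?_ ?_ ?_
    · rintro ⟨x, y⟩ hp
      obtain ⟨hx, hy, hne⟩ := Finset.mem_offDiag.1 hp
      simp only at hx hy hne ⊢
      rw [Finset.erase_right_comm (a := y), ← Finsupp.single_add]
      rcases lt_or_gt_of_ne hne with h | h
      · rw [erase_sign_add_swap F hx h, Finsupp.single_zero]
      · rw [add_comm, erase_sign_add_swap F hy h, Finsupp.single_zero]
    · rintro ⟨x, y⟩ hp _ h
      exact (Finset.mem_offDiag.1 hp).2.2 (congrArg Prod.snd h)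
    · rintro ⟨x, y⟩ hp
      obtain ⟨hx, hy, hne⟩ := Finset.mem_offDiag.1 hp
      exact Finset.mem_offDiag.2 ⟨hy, hx, Ne.symm hne⟩
    · intro p _
      rfl

theorem simplexBoundary_mem_boundaries {L : PreAbstractSimplicialComplex V} {n : ℕ}
    {s : Finset V} (hs : s ∈ L) (hc : s.card = n + 2) :
    simplexBoundary F s ∈ boundaries F L n := by
  refine ⟨Finsupp.single s 1, Finsupp.single_mem_supported F 1 ⟨hs, hc⟩, ?_⟩
  rw [boundary_single, one_smul]

theorem boundaries_le_iff {L : PreAbstractSimplicialComplex V} {n : ℕ}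
    {S : Submodule F (Finset V →₀ F)} :
    boundaries F L n ≤ S ↔ ∀ s ∈ L, s.card = n + 2 → simplexBoundary F s ∈ S := by
  constructor
  · exact fun h s hs hc => h (simplexBoundary_mem_boundaries F hs hc)
  · rintro h _ ⟨c, hc, rfl⟩
    rw [boundary, Finsupp.linearCombination_apply, Finsupp.sum]
    refine Submodule.sum_mem _ fun s hs => S.smul_mem _ ?_
    have := (mem_chains_iff F).1 hc s (Finsupp.mem_support_iff.1 hs)
    exact h s this.1 this.2

/-- A simplex without cofaces in `L` has coefficient zero in every boundary of `L`. -/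
theorem apply_eq_zero_of_mem_boundaries {L : PreAbstractSimplicialComplex V} {n : ℕ}
    {t : Finset V} (ht : ∀ s ∈ L, t ⊆ s → s = t) {z : Finset V →₀ F}
    (hz : z ∈ boundaries F L n) : z t = 0 := by
  have h : boundaries F L n ≤ LinearMap.ker (Finsupp.lapply t : (Finset V →₀ F) →ₗ[F] F) := by
    rw [boundaries_le_iff]
    intro s hs _
    by_contra hne
    obtain ⟨_, x, hx, rfl⟩ := exists_eq_erase_of_simplexBoundary_ne_zero F hne
    have := ht s hs (Finset.erase_subset x s)
    exact Finset.notMem_erase x s (this ▸ hx)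
  exact h hz

end Chains

/-! ## Sublevel filtrations -/

section Sublevels

variable {V : Type u} [LinearOrder V] {K : PreAbstractSimplicialComplex V}

theorem mem_sublevel_iff (f : FiltrationFunction K) (r : ℝ) (σ : K) :
    (σ : Finset V) ∈ sublevel f r ↔ f σ ≤ r :=
  ⟨fun ⟨_, h⟩ => h, fun h => ⟨σ.2, h⟩⟩

/-- Finitely many simplices make the filtration constant just to the right of each level, so that
infima of levels are attained. -/
theorem exists_gt_sublevel_le [Finite K] (f : FiltrationFunction K) (b : ℝ) :
    ∃ q > b, sublevel f q ≤ sublevel f b := by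
  have h : ∀ᶠ q in 𝓝[>] b, ∀ σ : K, f σ ≤ q → f σ ≤ b := by
    refine eventually_all.2 fun σ => ?_
    by_cases hσ : f σ ≤ b
    · exact Eventually.of_forall fun _ _ => hσ
    · filter_upwards [mem_nhdsWithin_of_mem_nhds (Iio_mem_nhds (not_le.1 hσ))] with q hq h
      exact absurd h (not_le.2 hq)
  obtain ⟨q, hq, hbq⟩ := (h.and self_mem_nhdsWithin).exists
  exact ⟨q, hbq, fun s ⟨hs, hsq⟩ => ⟨hs, hq _ hsq⟩⟩

theorem exists_lt_forall_le [Finite K] (f : FiltrationFunction K) (b : ℝ) :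
    ∃ q < b, ∀ σ : K, f σ < b → f σ ≤ q := by
  have h : ∀ᶠ q in 𝓝[<] b, ∀ σ : K, f σ < b → f σ ≤ q := by
    refine eventually_all.2 fun σ => ?_
    by_cases hσ : f σ < b
    · filter_upwards [mem_nhdsWithin_of_mem_nhds (Ioi_mem_nhds hσ)] with q hq _
      exact le_of_lt hq
    · exact Eventually.of_forall fun _ h => absurd h hσ
  obtain ⟨q, hq, hbq⟩ := (h.and self_mem_nhdsWithin).exists
  exact ⟨q, hbq, hq⟩

theorem abs_sub_le_of_norm_le [Fintype K] (f g : FiltrationFunction K) {ε : ℝ}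
    (h : ‖f.toFun - g.toFun‖ ≤ ε) (σ : K) : |f σ - g σ| ≤ ε := by
  have h1 := (norm_le_pi_norm (f.toFun - g.toFun) σ).trans h
  rwa [Pi.sub_apply, Real.norm_eq_abs] at h1

variable (F : Type v) [Field F]

/-- The chain `z` becomes a boundary in the filtration `K^f` at level `b`, and not earlier. -/
def BecomesBoundaryAt (f : FiltrationFunction K) (n : ℕ) (z : Finset V →₀ F) (b : ℝ) : Prop :=
  z ∈ boundaries F (sublevel f b) n ∧ ∀ q < b, z ∉ boundaries F (sublevel f q) n

theorem homologyMap_mk_eq_zero_iff {L L' : PreAbstractSimplicialComplex V} (h : L ≤ L') (n : ℕ)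
    (z : cycles F L n) :
    homologyMap F h n (Submodule.Quotient.mk z) = 0 ↔ (z : Finset V →₀ F) ∈ boundaries F L' n := by
  exact Submodule.Quotient.mk_eq_zero _ (x := Submodule.inclusion (cycles_mono F h n) z)

theorem mk_eq_zero_iff_mem_boundaries {L : PreAbstractSimplicialComplex V} (n : ℕ)
    (z : cycles F L n) :
    (Submodule.Quotient.mk z : homology F L n) = 0 ↔ (z : Finset V →₀ F) ∈ boundaries F L n := by
  rw [Submodule.Quotient.mk_eq_zero]
  rfl

/-- The termination scale is only an infimum; right-constancy of the filtration turns it into an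
actual first level at which the representing cycle bounds. -/
theorem becomesBoundaryAt_of_isTerminatedAt [Finite K] {f : FiltrationFunction K} {n : ℕ}
    {r b : ℝ} {z : cycles F (sublevel f r) n}
    (h : (persistentHomology F f n).IsTerminatedAt (r := r) (Submodule.Quotient.mk z) b) :
    BecomesBoundaryAt F f n z b := by
  obtain ⟨hne, ht⟩ := h
  have hnot : (z : Finset V →₀ F) ∉ boundaries F (sublevel f r) n :=
    fun hz => hne ((mk_eq_zero_iff_mem_boundaries F n z).2 hz)
  constructor
  · obtain ⟨q, hbq, hq⟩ := exists_gt_sublevel_le f b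
    have hlt : (persistentHomology F f n).terminationScale (r := r) (Submodule.Quotient.mk z)
        < (q : EReal) := by
      rw [ht]
      exact EReal.coe_lt_coe_iff.2 hbq
    obtain ⟨_, ⟨q', hrq', rfl, hzero⟩, hq'⟩ := sInf_lt_iff.1 hlt
    have h1 := (homologyMap_mk_eq_zero_iff F (sublevel_mono f hrq') n z).1 hzero
    exact boundaries_mono F ((sublevel_mono f (EReal.coe_lt_coe_iff.1 hq').le).trans hq) n h1
  · intro q hq hz
    by_cases hrq : r ≤ q
    · refine not_le.2 (EReal.coe_lt_coe_iff.2 hq) (ht ▸ sInf_le ⟨q, hrq, rfl, ?_⟩)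
      exact (homologyMap_mk_eq_zero_iff F (sublevel_mono f hrq) n z).2 hz
    · exact hnot (boundaries_mono F (sublevel_mono f (not_le.1 hrq).le) n hz)

theorem BecomesBoundaryAt.isTerminatedAt {f : FiltrationFunction K} {n : ℕ}
    {r b : ℝ} {z : cycles F (sublevel f r) n} (h : BecomesBoundaryAt F f n z b) (hrb : r < b) :
    (persistentHomology F f n).IsTerminatedAt (r := r) (Submodule.Quotient.mk z) b := by
  refine ⟨fun h0 => h.2 r hrb ((mk_eq_zero_iff_mem_boundaries F n z).1 h0), ?_⟩
  refine le_antisymm (sInf_le ⟨b, hrb.le, rfl, ?_⟩) (le_sInf ?_)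
  · exact (homologyMap_mk_eq_zero_iff F (sublevel_mono f hrb.le) n z).2 h.1
  · rintro _ ⟨q, hrq, rfl, hzero⟩
    refine EReal.coe_le_coe_iff.2 (not_lt.1 fun hq => h.2 q hq ?_)
    exact (homologyMap_mk_eq_zero_iff F (sublevel_mono f hrq) n z).1 hzero

/-- A chain with boundary `z` that lives in `K^f_b` contains the simplex of level `b` if `z` becomes
a boundary at `b`. -/
theorem BecomesBoundaryAt.exists_apply_ne_zero [Finite K] {f : FiltrationFunction K} {n : ℕ}
    {z : Finset V →₀ F} {b : ℝ} (h : BecomesBoundaryAt F f n z b) {c : Finset V →₀ F}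
    (hc : c ∈ chains F (sublevel f b) (n + 1)) (hz : boundary F c = z) :
    ∃ σ : K, f σ = b ∧ c σ ≠ 0 := by
  by_contra! hcon
  -- Without a simplex of level b, the whole chain would already be present at the last level before
  -- b.
  obtain ⟨q, hqb, hq⟩ := exists_lt_forall_le f b
  refine h.2 q hqb ⟨c, (mem_chains_iff F).2 fun s hs => ?_, hz⟩
  obtain ⟨⟨hsK, hsb⟩, hcard⟩ := (mem_chains_iff F).1 hc s hs
  exact ⟨⟨hsK, hq _ (lt_of_le_of_ne hsb fun he => hs (hcon ⟨s, hsK⟩ he))⟩, hcard⟩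

/-- The boundary of an `(n+1)`-simplex is an `n`-cycle of every sublevel complex that contains
its proper faces. -/
theorem simplexBoundary_mem_cycles {f : FiltrationFunction K} {n : ℕ} {τ : K}
    (hτ : (τ : Finset V).card = n + 2) {q : ℝ} (hq : ∀ ρ : K, f ρ < f τ → f ρ ≤ q) :
    simplexBoundary F (τ : Finset V) ∈ cycles F (sublevel f q) n := by
  refine ⟨(mem_chains_iff F).2 fun t ht => ?_, boundary_simplexBoundary F _⟩
  obtain ⟨_, x, hx, rfl⟩ := exists_eq_erase_of_simplexBoundary_ne_zero F ht
  have hcard : ((τ : Finset V).erase x).card = n + 1 := by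
    rw [Finset.card_erase_of_mem hx, hτ]
    rfl
  have hsub := Finset.erase_subset x (τ : Finset V)
  have hK : (τ : Finset V).erase x ∈ K :=
    (K.isRelLowerSet_faces τ.2).2 hsub (Finset.card_pos.1 (by omega))
  refine ⟨⟨hK, hq _ (lt_of_le_of_ne (f.mono _ _ hsub) fun he => ?_)⟩, hcard⟩
  have := congrArg Finset.card (congrArg Subtype.val (f.injective he))
  rw [hcard, hτ] at this
  omega

/-- If no terminal `(n+1)`-simplex arrives in `(a, b)`, then all boundaries present before `b` are
present at `a`. -/
theorem boundaries_sublevel_le_of_forall_isTerminalSimplex [Finite K] {f : FiltrationFunction K}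
    {n : ℕ} {a b : ℝ} (h : ∀ τ : K, IsTerminalSimplex F f n τ → f τ < b → f τ ≤ a) {r : ℝ}
    (hr : r < b) : boundaries F (sublevel f r) n ≤ boundaries F (sublevel f a) n := by
  rw [boundaries_le_iff]
  rintro s ⟨hsK, hsr⟩ hcard
  by_contra hs
  -- Take the earliest offending simplex. Up to just before its arrival all boundaries lie in those
  -- at level a, so its own boundary is a non-trivial cycle which it terminates. It is thus a
  -- terminal simplex in (a, b).
  obtain ⟨τ, ⟨hτb, hτcard, hτ⟩, hmin⟩ := Set.exists_min_image
    {τ : K | f τ < b ∧ (τ : Finset V).card = n + 2 ∧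
      simplexBoundary F (τ : Finset V) ∉ boundaries F (sublevel f a) n} f (Set.toFinite _)
    ⟨⟨s, hsK⟩, hsr.trans_lt hr, hcard, hs⟩
  obtain ⟨q, hqτ, hq⟩ := exists_lt_forall_le f (f τ)
  have hτa : a < f τ := not_le.1 fun hle =>
    hτ (simplexBoundary_mem_boundaries F ((mem_sublevel_iff f a τ).2 hle) hτcard)
  have hle : boundaries F (sublevel f q) n ≤ boundaries F (sublevel f a) n := by
    rw [boundaries_le_iff]
    rintro t ⟨htK, htq⟩ htcard
    by_contra ht
    exact not_lt.2 (hmin ⟨t, htK⟩ ⟨(htq.trans_lt hqτ).trans hτb, htcard, ht⟩) (htq.trans_lt hqτ)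
  refine not_le.2 hτa (h τ ⟨hτcard, q, Submodule.Quotient.mk
    ⟨simplexBoundary F (τ : Finset V), simplexBoundary_mem_cycles F hτcard hq⟩, ?_⟩ hτb)
  refine BecomesBoundaryAt.isTerminatedAt F
    ⟨simplexBoundary_mem_boundaries F ((mem_sublevel_iff f _ τ).2 le_rfl) hτcard, ?_⟩ hqτ
  intro q' hq' hmem
  refine hτ (hle (boundaries_mono F ?_ n hmem))
  exact fun t ⟨htK, ht⟩ => ⟨htK, hq _ (ht.trans_lt hq')⟩

/-- The simplex of highest level in an `m`-cycle is a birth simplex. -/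
theorem isBirthSimplex_of_cycle {f : FiltrationFunction K} {m : ℕ} {ρ : K} {d : Finset V →₀ F}
    (hd : d ∈ cycles F (sublevel f (f ρ)) m) (hρ : d ρ ≠ 0) : IsBirthSimplex F f m ρ := by
  -- By injectivity ρ has no proper coface at its own level, so the coefficient at ρ is an invariant
  -- of homology classes there. It vanishes on classes from earlier levels but not on that of d.
  have hcoface : ∀ s ∈ sublevel f (f ρ), (ρ : Finset V) ⊆ s → s = ρ := by
    rintro s ⟨hsK, hs⟩ hsub
    exact congrArg Subtype.val (f.injective (le_antisymm hs (f.mono ρ ⟨s, hsK⟩ hsub)))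
  refine ⟨((mem_chains_iff F).1 hd.1 ρ hρ).2, Submodule.Quotient.mk ⟨d, hd⟩, ?_, ?_⟩
  · exact fun h0 => hρ (apply_eq_zero_of_mem_boundaries F hcoface
      ((mk_eq_zero_iff_mem_boundaries F m ⟨d, hd⟩).1 h0))
  · refine le_antisymm (sInf_le ⟨f ρ, le_rfl, rfl, Submodule.Quotient.mk ⟨d, hd⟩, ?_⟩) (le_sInf ?_)
    · exact (persistentHomology F f m).map_id _ _
    · rintro _ ⟨q, hq, rfl, y, hy⟩
      refine EReal.coe_le_coe_iff.2 (not_lt.1 fun hlt => ?_)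
      obtain ⟨y, rfl⟩ := Submodule.Quotient.mk_surjective _ y
      have h1 : (Submodule.Quotient.mk (Submodule.inclusion
            (cycles_mono F (sublevel_mono f hq) m) y) : homology F (sublevel f (f ρ)) m)
          = Submodule.Quotient.mk ⟨d, hd⟩ := hy
      rw [Submodule.Quotient.eq] at h1
      have h2 := apply_eq_zero_of_mem_boundaries F hcoface h1
      have h3 : (y : Finset V →₀ F) ρ = 0 := by
        by_contra hne
        exact not_le.2 hlt ((mem_sublevel_iff f q ρ).1 ((mem_chains_iff F).1 y.2.1 ρ hne).1)
      refine hρ ?_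
      have h4 : (y : Finset V →₀ F) ρ - d ρ = 0 := h2
      rwa [h3, zero_sub, neg_eq_zero] at h4

end Sublevels

/-! ## Termination scales and interval decompositions -/

namespace PersistenceModule

variable {F : Type v} [Field F]

namespace IntervalDecomposition

variable {M : PersistenceModule.{v, w} F} {I : Type w'} [Finite I]

/-- The component of `x` in the bar `i`. -/
noncomputable def component (D : IntervalDecomposition M I) {r : ℝ} (x : M.obj r) (i : I) : F :=
  ((D.iso.equiv r x : ∀ i, (intervalModule F (D.lo i) (D.hi i)).obj r) i :
    intervalSpace F (D.lo i) (D.hi i) r).1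

theorem mem_bar_of_component_ne_zero (D : IntervalDecomposition M I) {r : ℝ} {x : M.obj r} {i : I}
    (h : D.component x i ≠ 0) : D.lo i ≤ r ∧ (r : EReal) < D.hi i := by
  by_contra hcon
  exact h (((D.iso.equiv r x : ∀ i, (intervalModule F (D.lo i) (D.hi i)).obj r) i :
    intervalSpace F (D.lo i) (D.hi i) r).2 hcon)

theorem eq_zero_iff_component (D : IntervalDecomposition M I) {r : ℝ} (x : M.obj r) :
    x = 0 ↔ ∀ i, D.component x i = 0 := by
  rw [← (D.iso.equiv r).map_eq_zero_iff]
  constructor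
  · intro h i
    unfold component
    rw [h]
    rfl
  · exact fun h => funext fun i => Subtype.ext (h i)

open scoped Classical in
theorem component_map (D : IntervalDecomposition M I) {q r : ℝ} (h : q ≤ r) (x : M.obj q) (i : I) :
    D.component (M.map h x) i =
      if D.lo i ≤ r ∧ (r : EReal) < D.hi i then D.component x i else 0 := by
  unfold component
  rw [D.iso.comm h x]
  rfl

/-- A non-zero component places q inside the bar, so only the right endpoint can kill that component
later. -/
theorem map_eq_zero_iff (D : IntervalDecomposition M I) {q r : ℝ} (h : q ≤ r) (x : M.obj q) :
    M.map h x = 0 ↔ ∀ i, D.component x i ≠ 0 → D.hi i ≤ r := by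
  rw [D.eq_zero_iff_component]
  refine forall_congr' fun i => ?_
  rw [D.component_map]
  constructor
  · intro hi hne
    by_contra hlt
    rw [if_pos ⟨(D.mem_bar_of_component_ne_zero hne).1.trans h, not_le.1 hlt⟩] at hi
    exact hne hi
  · intro hi
    split_ifs with hbar
    · by_contra hne
      exact not_lt.2 (hi hne) hbar.2
    · rfl

/-- A non-trivial element terminates at the right endpoint of a bar in which it has a non-zero
component. -/
theorem exists_terminationScale_eq (D : IntervalDecomposition M I) {r : ℝ} {x : M.obj r}
    (hx : x ≠ 0) : ∃ i, D.component x i ≠ 0 ∧ M.terminationScale x = D.hi i := by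
  have hne : ∃ i, D.component x i ≠ 0 := by
    by_contra! h
    exact hx ((D.eq_zero_iff_component x).2 h)
  -- The element vanishes once all bars carrying it have ended, so the one ending last decides.
  obtain ⟨i, hi, hmax⟩ := Set.exists_max_image {i | D.component x i ≠ 0} D.hi (Set.toFinite _) hne
  refine ⟨i, hi, le_antisymm ?_ (le_sInf ?_)⟩
  · obtain ⟨_, hri⟩ := D.mem_bar_of_component_ne_zero hi
    induction hb : D.hi i with
    | bot => rw [hb] at hri; exact absurd hri not_lt_bot
    | top => exact le_top
    | coe b =>
      rw [hb] at hri
      have hrb := (EReal.coe_lt_coe_iff.1 hri).le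
      exact sInf_le ⟨b, hrb, rfl, (D.map_eq_zero_iff hrb x).2 fun k hk => hb ▸ hmax k hk⟩
  · rintro _ ⟨q, hrq, rfl, hq⟩
    exact (D.map_eq_zero_iff hrq x).1 hq i hi

end IntervalDecomposition

end PersistenceModule

/-! ## Perturbation of a filtration -/

section Perturbation

variable {V : Type u} [LinearOrder V] {K : PreAbstractSimplicialComplex V} [Fintype K]
variable (F : Type v) [Field F]

/-- A class that dies under the perturbation dies in the original filtration at most `ε` later. -/
theorem map_eq_zero_of_map_perturbationMap_eq_zero {f g : FiltrationFunction K} {ε : ℝ}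
    (hfg : ‖f.toFun - g.toFun‖ ≤ ε) {n : ℕ} {r q s : ℝ}
    (x : (persistentHomology F f n).obj r) (hrq : r + ε ≤ q) (hqs : q + ε ≤ s) (hrs : r ≤ s)
    (h : (persistentHomology F g n).map hrq (perturbationMap F f g hfg n r x) = 0) :
    (persistentHomology F f n).map hrs x = 0 := by
  obtain ⟨z, rfl⟩ := Submodule.Quotient.mk_surjective _ x
  have h1 := (homologyMap_mk_eq_zero_iff F
    ((sublevel_le_of_norm_le f g hfg r).trans (sublevel_mono g hrq)) n z).1 h
  rw [norm_sub_rev] at hfg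
  -- A filling at level q for g is a filling at level q + ε for f.
  exact (homologyMap_mk_eq_zero_iff F (sublevel_mono f hrs) n z).2 (boundaries_mono F
    ((sublevel_le_of_norm_le g f hfg q).trans (sublevel_mono f hqs)) n h1)

/-- If a chain becomes a boundary at `b` in `K^f` and at a level within `ε` of `b` in `K^g`, then
the same simplex is responsible, provided that in `K^f` no birth `(n+1)`-simplex arrives in
`(b, b + 2ε)` and no terminal `(n+1)`-simplex arrives in `(b - 2ε, b)`. -/
theorem exists_common_simplex_of_becomesBoundaryAt {f g : FiltrationFunction K} {ε : ℝ}
    (hfg : ‖f.toFun - g.toFun‖ ≤ ε) {n : ℕ} {z : Finset V →₀ F} {b b' : ℝ}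
    (hf : BecomesBoundaryAt F f n z b) (hg : BecomesBoundaryAt F g n z b') (hbb' : |b - b'| ≤ ε)
    (hu : ∀ ρ : K, IsBirthSimplex F f (n + 1) ρ → b < f ρ → b + 2 * ε ≤ f ρ)
    (hl : ∀ ρ : K, IsTerminalSimplex F f n ρ → f ρ < b → f ρ ≤ b - 2 * ε) :
    ∃ σ : K, (σ : Finset V).card = n + 2 ∧ f σ = b ∧ g σ = b' := by
  have hgf : ‖g.toFun - f.toFun‖ ≤ ε := by rwa [norm_sub_rev]
  obtain ⟨hbb1, hbb2⟩ := abs_le.1 hbb'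
  obtain ⟨c, hc, hcz⟩ := hf.1
  obtain ⟨c', hc', hcz'⟩ := hg.1
  have memc := (mem_chains_iff F).1 hc
  have memc' := (mem_chains_iff F).1 hc'
  -- The candidate is the simplex of g-level b'; every filling of z at b' for g must contain it.
  obtain ⟨τ, hτ, hτc⟩ := hg.exists_apply_ne_zero F hc' hcz'
  have hτcard : (τ : Finset V).card = n + 2 := (memc' τ hτc).2
  rcases lt_trichotomy (f τ) b with hlt | heq | hgt
  -- In the extreme case b' = b - ε, the chain c' is also a filling for f at b, so it contains the
  -- simplex of f-level b, and the bounds on f - g force its g-level to be b'.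
  · rcases eq_or_lt_of_le (show b - ε ≤ b' by linarith) with hb' | hb'
    · have hc'f : c' ∈ chains F (sublevel f b) (n + 1) :=
        chains_mono F ((sublevel_le_of_norm_le g f hgf b').trans (sublevel_mono f (by linarith)))
          _ hc'
      obtain ⟨σ, hσ, hσc⟩ := hf.exists_apply_ne_zero F hc'f hcz'
      have h1 := (mem_sublevel_iff g b' σ).1 (memc' σ hσc).1
      have h2 := abs_le.1 (abs_sub_le_of_norm_le f g hfg σ)
      exact ⟨σ, (memc' σ hσc).2, hσ, le_antisymm h1 (by linarith [h2.2])⟩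
    -- By the lower gap, ∂τ already bounds at b - 2ε for f, hence at b - ε < b' for g. That filling
    -- e is too early to contain τ.
    · have hmem := boundaries_sublevel_le_of_forall_isTerminalSimplex F hl hlt
        (simplexBoundary_mem_boundaries F ((mem_sublevel_iff f _ τ).2 le_rfl) hτcard)
      obtain ⟨e, he, hez⟩ := boundaries_mono F (sublevel_le_of_norm_le f g hfg _) n hmem
      have heb' : e ∈ chains F (sublevel g b') (n + 1) :=
        chains_mono F (sublevel_mono g (by linarith)) _ he
      have heτ : e τ = 0 := by
        by_contra hne
        have := (mem_sublevel_iff g _ τ).1 ((mem_chains_iff F).1 he τ hne).1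
        linarith
      have hsingle : Finsupp.single (τ : Finset V) (1 : F) ∈ chains F (sublevel g b') (n + 1) :=
        Finsupp.single_mem_supported F 1 ⟨(mem_sublevel_iff g b' τ).2 hτ.le, hτcard⟩
      -- Exchanging τ for e in c' gives another filling of z at b', with coefficient zero at τ.
      obtain ⟨σ, hσ, hσc⟩ := hg.exists_apply_ne_zero F
        (c := c' + c' τ • (e - Finsupp.single (τ : Finset V) 1))
        (Submodule.add_mem _ hc' (Submodule.smul_mem _ _ (Submodule.sub_mem _ heb' hsingle)))
        (by rw [map_add, map_smul, map_sub, hez, boundary_single, one_smul, sub_self, smul_zero,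
          add_zero, hcz'])
      obtain rfl : σ = τ := g.injective (hσ.trans hτ.symm)
      refine absurd ?_ hσc
      simp [heτ]
  · exact ⟨τ, hτcard, heq, hτ⟩
  · have hcτ : c τ = 0 := by
      by_contra hne
      exact not_le.2 hgt ((mem_sublevel_iff f b τ).1 (memc τ hne).1)
    -- The f-highest simplex of the cycle c' - c is a birth simplex; it lies above b because τ
    -- occurs in the cycle, and so it belongs to c'.
    obtain ⟨ρ, hρ, hmax⟩ := Set.exists_max_image {ρ : K | (c' - c) ρ ≠ 0} f (Set.toFinite _)
      ⟨τ, by simpa [hcτ] using hτc⟩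
    have hρb : b < f ρ := hgt.trans_le (hmax τ (by simpa [hcτ] using hτc))
    have hcρ : c ρ = 0 := by
      by_contra hne
      exact not_le.2 hρb ((mem_sublevel_iff f b ρ).1 (memc ρ hne).1)
    have hc'ρ : c' ρ ≠ 0 := by simpa [hcρ] using hρ
    have hd : c' - c ∈ cycles F (sublevel f (f ρ)) (n + 1) := by
      refine ⟨(mem_chains_iff F).2 fun s hs => ?_, ?_⟩
      · have hs' : s ∈ K ∧ s.card = n + 1 + 1 := by
          by_cases hcs : c s = 0
          · have := memc' s (by simpa [hcs] using hs)
            exact ⟨this.1.1, this.2⟩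
          · exact ⟨(memc s hcs).1.1, (memc s hcs).2⟩
        exact ⟨⟨hs'.1, hmax ⟨s, hs'.1⟩ hs⟩, hs'.2⟩
      · rw [SetLike.mem_coe, LinearMap.mem_ker, map_sub, hcz, hcz', sub_self]
    have h1 := hu ρ (isBirthSimplex_of_cycle F hd hρ) hρb
    have h2 := (mem_sublevel_iff g b' ρ).1 (memc' ρ hc'ρ).1
    have h3 := abs_le.1 (abs_sub_le_of_norm_le f g hfg ρ)
    -- The upper gap and membership in c' give b + 2ε ≤ f ρ ≤ g ρ + ε ≤ b' + ε. Hence b + ε ≤ b',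
    -- and c is a filling for g at b' that misses τ.
    have hcg : c ∈ chains F (sublevel g b') (n + 1) :=
      chains_mono F ((sublevel_le_of_norm_le f g hfg b).trans
        (sublevel_mono g (by linarith [h3.2]))) _ hc
    obtain ⟨σ, hσ, hσc⟩ := hg.exists_apply_ne_zero F hcg hcz
    obtain rfl : σ = τ := g.injective (hσ.trans hτ.symm)
    exact absurd hcτ hσc

/-- A class of `K^f` terminating at `b` that becomes `β` in `K^g` terminates in `K^g` no earlier
than `b - ε`. -/
theorem le_terminationScale_perturbationMap_add {f g : FiltrationFunction K} {ε : ℝ}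
    (hfg : ‖f.toFun - g.toFun‖ ≤ ε) {n : ℕ} {r : ℝ} (x : (persistentHomology F f n).obj r) :
    (persistentHomology F f n).terminationScale x ≤
      (persistentHomology F g n).terminationScale (perturbationMap F f g hfg n r x) + (ε : EReal) := by
  have hε : 0 ≤ ε := (norm_nonneg _).trans hfg
  rw [← EReal.sub_le_iff_le_add (Or.inl (EReal.coe_ne_bot ε)) (Or.inl (EReal.coe_ne_top ε))]
  refine le_sInf ?_
  rintro _ ⟨q, hrq, rfl, hq⟩
  rw [EReal.sub_le_iff_le_add (Or.inl (EReal.coe_ne_bot ε)) (Or.inl (EReal.coe_ne_top ε)),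
    ← EReal.coe_add]
  have hrs : r ≤ q + ε := by linarith
  exact sInf_le ⟨q + ε, hrs, rfl,
    map_eq_zero_of_map_perturbationMap_eq_zero F hfg x hrq le_rfl hrs hq⟩

/-- The 2ε is the cost of passing from f to g and back. -/
theorem perturbationMap_ne_zero {f g : FiltrationFunction K} {ε : ℝ}
    (hfg : ‖f.toFun - g.toFun‖ ≤ ε) {n : ℕ} {r : ℝ} (x : (persistentHomology F f n).obj r)
    (hx : ((r + 2 * ε : ℝ) : EReal) < (persistentHomology F f n).terminationScale x) :
    perturbationMap F f g hfg n r x ≠ 0 := by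
  have hε : 0 ≤ ε := (norm_nonneg _).trans hfg
  intro h
  have hrs : r ≤ r + 2 * ε := by linarith
  refine not_le.2 hx (sInf_le ⟨r + 2 * ε, hrs, rfl, ?_⟩)
  refine map_eq_zero_of_map_perturbationMap_eq_zero F hfg x (le_refl (r + ε)) (by linarith) hrs ?_
  rw [h, map_zero]

/-- A class terminating together with an isolated long bar terminates, after a perturbation, at the
right endpoint of the bar to which that bar is matched. -/
theorem isTerminatedAt_perturbationMap {f g : FiltrationFunction K} {n : ℕ}
    {I : Type w} [Finite I] (Df : (persistentHomology F f n).IntervalDecomposition I) (i₀ : I)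
    {α : (persistentHomology F f n).obj (Df.lo i₀)}
    (hα : (persistentHomology F f n).IsTerminatedAt α (Df.hi i₀))
    {ε : ℝ} (hε : ((Df.lo i₀ + 4 * ε : ℝ) : EReal) < Df.hi i₀)
    (hother : ∀ i : I, i ≠ i₀ →
      Df.lo i₀ + 2 * ε < Df.lo i ∨ Df.hi i < Df.hi i₀ - ((2 * ε : ℝ) : EReal))
    (hfg : ‖f.toFun - g.toFun‖ ≤ ε)
    {J : Type w'} [Finite J] (Dg : (persistentHomology F g n).IntervalDecomposition J)
    (m : PersistenceModule.Matching ε Df Dg) {j₀ : J} (hm : m.Matches i₀ j₀) :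
    (persistentHomology F g n).IsTerminatedAt
      (perturbationMap F f g hfg n (Df.lo i₀) α) (Dg.hi j₀) := by
  have hε0 : 0 ≤ ε := (norm_nonneg _).trans hfg
  have hβ : perturbationMap F f g hfg n (Df.lo i₀) α ≠ 0 := by
    refine perturbationMap_ne_zero F hfg α (lt_of_le_of_lt ?_ (hα.2 ▸ hε))
    exact EReal.coe_le_coe_iff.2 (by linarith)
  refine ⟨hβ, ?_⟩
  obtain ⟨j, hj, hT⟩ := Dg.exists_terminationScale_eq hβ
  have hlow := le_terminationScale_perturbationMap_add F hfg α
  rw [hT, hα.2] at hlow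
  have hloj := (Dg.mem_bar_of_component_ne_zero hj).1
  -- If j were unmatched, then b ≤ hi j + ε ≤ lo j + 3ε ≤ a + 4ε, against the length of the bar
  -- `i₀`.
  have hjJ : j ∈ m.J' := by
    by_contra hnot
    have h1 := hlow.trans (add_le_add_left (m.short_right j hnot) (ε : EReal))
    rw [← EReal.coe_add] at h1
    have h2 := EReal.coe_lt_coe_iff.1 (hε.trans_le h1)
    linarith
  obtain ⟨i, hi⟩ := m.φ.surjective ⟨j, hjJ⟩
  have hij : (m.φ i : J) = j := congrArg Subtype.val hi
  -- The partner starts by a + 2ε and ends no earlier than b - 2ε, so both alternatives for other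
  -- bars fail.
  have hi0 : (i : I) = i₀ := by
    by_contra hne
    have h1 := (abs_le.1 (m.lo_close i)).2
    have h2 := (m.hi_close i).2
    rw [hij] at h1 h2
    rcases hother i hne with h | h
    · linarith
    · refine not_le.2 h ?_
      rw [EReal.sub_le_iff_le_add (Or.inl (EReal.coe_ne_bot _)) (Or.inl (EReal.coe_ne_top _)),
        two_mul, EReal.coe_add, ← add_assoc]
      exact hlow.trans (add_le_add_left h2 _)
  obtain ⟨h0, hφ⟩ := hm
  have : i = ⟨i₀, h0⟩ := Subtype.ext hi0
  rw [hT, ← hij, this, hφ]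

theorem add_le_of_isBirthSimplex {f : FiltrationFunction K} {n : ℕ} {b δ : ℝ}
    (h : (δ : EReal) ≤ upperGap F f n b) {ρ : K} (hρ : IsBirthSimplex F f (n + 1) ρ)
    (hb : b < f ρ) : b + δ ≤ f ρ := by
  have h1 := EReal.coe_le_coe_iff.1 (h.trans (sInf_le ⟨ρ, hρ, hb, rfl⟩))
  rw [abs_of_pos (by linarith)] at h1
  linarith

theorem le_sub_of_isTerminalSimplex {f : FiltrationFunction K} {n : ℕ} {b δ : ℝ}
    (h : (δ : EReal) ≤ lowerGap F f n b) {ρ : K} (hρ : IsTerminalSimplex F f n ρ)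
    (hb : f ρ < b) : f ρ ≤ b - δ := by
  have h1 := EReal.coe_le_coe_iff.1 (h.trans (sInf_le ⟨ρ, hρ, hb, rfl⟩))
  rw [abs_of_neg (by linarith)] at h1
  linarith

theorem terminatesBar_iff_eq {f : FiltrationFunction K} {n : ℕ} {b r : ℝ} {σ : K}
    (hcard : (σ : Finset V).card = n + 2) (hσ : f σ = b) {x : (persistentHomology F f n).obj r}
    (hx : (persistentHomology F f n).IsTerminatedAt x b) (τ : K) :
    TerminatesBar F f n b τ ↔ τ = σ := by
  constructor
  · exact fun h => f.injective ((EReal.coe_eq_coe_iff.1 h.2).trans hσ.symm)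
  · rintro rfl
    exact ⟨⟨hcard, r, x, by rwa [hσ]⟩, by rw [hσ]⟩

end Perturbation

end PersistentRigidity

theorem mainTheorem2
    {V : Type*} [LinearOrder V] {F : Type*} [Field F]
    (K : PreAbstractSimplicialComplex V) [Fintype K]
    (f : PersistentRigidity.FiltrationFunction K) (n : ℕ)
    {I : Type*} [Finite I]
    (Df : (PersistentRigidity.persistentHomology F f n).IntervalDecomposition I)
    (i₀ : I)
    (α : (PersistentRigidity.persistentHomology F f n).obj (Df.lo i₀))
    (hα_born : (PersistentRigidity.persistentHomology F f n).IsBornAt α (Df.lo i₀))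
    (hα_term : (PersistentRigidity.persistentHomology F f n).IsTerminatedAt α (Df.hi i₀))
    (ε : ℝ) (hε : ((Df.lo i₀ + 4 * ε : ℝ) : EReal) < Df.hi i₀)
    (hother : ∀ i : I, i ≠ i₀ →
      Df.lo i₀ + 2 * ε < Df.lo i ∨ Df.hi i < Df.hi i₀ - ((2 * ε : ℝ) : EReal))
    (g : PersistentRigidity.FiltrationFunction K) (hfg : ‖f.toFun - g.toFun‖ ≤ ε)
    {J : Type*} [Finite J]
    (Dg : (PersistentRigidity.persistentHomology F g n).IntervalDecomposition J)
    (m : PersistentRigidity.PersistenceModule.Matching ε Df Dg)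
    (j₀ : J) (hm : m.Matches i₀ j₀) :
    (PersistentRigidity.persistentHomology F g n).IsTerminatedAt
        (PersistentRigidity.perturbationMap F f g hfg n (Df.lo i₀) α) (Dg.hi j₀) ∧
    (∀ b : ℝ, Df.hi i₀ = (b : EReal) →
      ((2 * ε : ℝ) : EReal) ≤
        min (PersistentRigidity.upperGap F f n b) (PersistentRigidity.lowerGap F f n b) →
      ∃ σ : K,
        (∀ τ : K, PersistentRigidity.TerminatesBar F f n (Df.hi i₀) τ ↔ τ = σ) ∧
        (∀ τ : K, PersistentRigidity.TerminatesBar F g n (Dg.hi j₀) τ ↔ τ = σ)) := by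
  have hβ := PersistentRigidity.isTerminatedAt_perturbationMap F Df i₀ hα_term hε hother hfg Dg m hm
  refine ⟨hβ, fun b hb hgap => ?_⟩
  obtain ⟨h0, hφ⟩ := hm
  have hclose := m.hi_close ⟨i₀, h0⟩
  rw [hφ, hb] at hclose
  rw [hb] at hα_term ⊢
  -- Closeness to the finite endpoint b makes the matched endpoint finite.
  induction hb' : Dg.hi j₀ with
  | bot =>
    rw [hb', EReal.bot_add] at hclose
    exact absurd hclose.1 (not_le.2 (EReal.bot_lt_coe b))
  | top =>
    rw [hb', ← EReal.coe_add] at hclose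
    exact absurd hclose.2 (not_le.2 (EReal.coe_lt_top _))
  | coe b' =>
    rw [hb', ← EReal.coe_add, ← EReal.coe_add, EReal.coe_le_coe_iff,
      EReal.coe_le_coe_iff] at hclose
    rw [hb'] at hβ
    -- Perturbation does not change the representing chain: the same z represents both classes,
    -- which makes the two filtrations comparable at chain level.
    obtain ⟨z, rfl⟩ := Submodule.Quotient.mk_surjective _ α
    obtain ⟨σ, hcard, hfσ, hgσ⟩ :=
      PersistentRigidity.exists_common_simplex_of_becomesBoundaryAt F hfg
        (PersistentRigidity.becomesBoundaryAt_of_isTerminatedAt F hα_term)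
        (PersistentRigidity.becomesBoundaryAt_of_isTerminatedAt F
          (z := Submodule.inclusion (PersistentRigidity.cycles_mono F
            (PersistentRigidity.sublevel_le_of_norm_le f g hfg _) n) z) hβ)
        (abs_le.2 ⟨by linarith [hclose.2], by linarith [hclose.1]⟩)
        (fun ρ => PersistentRigidity.add_le_of_isBirthSimplex F (hgap.trans (min_le_left _ _)))
        (fun ρ => PersistentRigidity.le_sub_of_isTerminalSimplex F (hgap.trans (min_le_right _ _)))
    exact ⟨σ, PersistentRigidity.terminatesBar_iff_eq F hcard hfσ hα_term,
      PersistentRigidity.terminatesBar_iff_eq F hcard hgσ hβ⟩
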